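/- Let $n\ge 2$, let $\mathbb{H}^n=\{x=(x_1,\dots,x_n)\in\mathbb{R}^n : x_1>0\}$ carry the hyperbolic metric $g_{\mathbb{H}^n}=x_1^{-2}\,(dx_1^2+\dots+dx_n^2)$, and let $\mathbb{H}^n\times_{-1}\mathbb{R}$ be the product $\mathbb{H}^n\times\mathbb{R}$ with the Lorentzian metric $g_{\mathbb{H}^n}-dt^2$. Put $\rho(x)=-\ln x_1$, so that the level sets of $\rho$ are the horospheres $\{x_1=\text{const}\}$ and $\operatorname{div}(\nabla\rho)=n-1$. Let $\Omega\subseteq\mathbb{H}^n$ be open and connected and let $u\in C^2(\Omega)$ be such that the graph map $\Gamma_u:\Omega\to\mathbb{H}^n\times_{-1}\mathbb{R}$, $\Gamma_u(p)=(p,u(p))$, is a time-like translator; that is, the induced metric on $\Omega$ is Lorentzian and the mean curvature vector $\mathbf{H}$ (the trace of the second fundamental form) satisfies $\mathbf{H}=(\partial_t)^{\perp}$. We say that $\Gamma_u$ is foliated by horospheres if its image is a union of sets $\{x_1=c\}\times\{t\}$ with $c>0$, $t\in\mathbb{R}$. For $x\neq\pm1$ put $$P(x)=-\tfrac14\ln|1-x|+\tfrac12\cdot\tfrac{1}{1-x}+\tfrac14\ln|1+x|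 ,$$ $P_1=P|_{(-\infty,-1)}$, $P_3=P|_{(1,\infty)}$; and, for $n>2$, $m=n-1$ and $x\ne\pm1,\,1/m$, put $$Q(x)=\tfrac{1}{2m-2}\ln|1-x|+\tfrac{1}{2m+2}\ln|1+x|-\tfrac{m}{m^2-1}\ln|1-mx| ,$$ $Q_1=Q|_{(-\infty,-1)}$, $Q_4=Q|_{(1,\infty)}$. Let $c_2=0$ and $c_n=\frac{n-1}{2n-n^2}\ln(n-1)$ for $n>2$. Then $\Gamma_u$ is foliated by horospheres if and only if there are an open interval $I\subseteq\mathbb{R}$, a number $s_0\in\mathbb{R}$ with $I\subseteq(-\infty,s_0+c_n)$, and a $C^2$ function $f:(-\infty,s_0+c_n)\to\mathbb{R}$ such that $\Omega=\rho^{-1}(I)$, $u=f\circ\rho$ on $\Omega$, and one of the following holds: 1. $n=2$, $P_1$ is a bijection onto $(-\infty,0)$, and $f'(s)=P_1^{-1}(s-s_0)$ for all $s<s_0$; 2. $n=2$, $P_3$ is a bijection onto $(-\infty,0)$, and $f'(s)=P_3^{-1}(s-s_0)$ for all $s<s_0$; 3. $n>2$, $Q_1$ is a bijection onto $(-\infty,c_n)$,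 and $f'(s)=Q_1^{-1}(s-s_0)$ for all $s<s_0+c_n$; 4. $n>2$, $Q_4$ is a bijection onto $(-\infty,c_n)$, and $f'(s)=Q_4^{-1}(s-s_0)$ for all $s<s_0+c_n$. -/

import Mathlib

open Set

noncomputable section

namespace HESU

/-! ### Immersions into a pseudo-Riemannian coordinate domain

Metrics, connections and second fundamental forms are written in global coordinates: `ι` indexes the
coordinates of the parameter domain, `κ` those of the ambient space. -/

section Immersions

variable {ι κ : Type*} [Fintype ι] [DecidableEq ι] [Fintype κ] [DecidableEq κ]

/-- The partial derivative `∂_i φ (x)`. -/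
def pd (φ : (ι → ℝ) → ℝ) (i : ι) (x : ι → ℝ) : ℝ :=
  fderiv ℝ φ x (Pi.single i 1)

/-- The Christoffel symbols `Γ^a_{bc}` of the Levi-Civita connection of the metric
`∑ g_{ab} dy^a dy^b` at the point `y`. -/
def christoffel (g : (κ → ℝ) → Matrix κ κ ℝ) (y : κ → ℝ) (a b c : κ) : ℝ :=
  (1 / 2) * ∑ d, (g y)⁻¹ a d *
    (pd (fun z => g z d c) b y + pd (fun z => g z d b) c y - pd (fun z => g z b c) d y)

/-- The coordinate tangent vector `∂_i F (x)` of a map `F`. -/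
def tangent (F : (ι → ℝ) → (κ → ℝ)) (x : ι → ℝ) (i : ι) : κ → ℝ :=
  fun a => pd (fun z => F z a) i x

/-- The pull-back `F^* g` of the ambient metric, as a matrix at the point `x`. -/
def inducedMetric (g : (κ → ℝ) → Matrix κ κ ℝ) (F : (ι → ℝ) → (κ → ℝ)) (x : ι → ℝ) :
    Matrix ι ι ℝ :=
  fun i j => ∑ a, ∑ b, g (F x) a b * tangent F x i a * tangent F x j b

/-- The orthogonal projection `X^⊥` of an ambient vector `X` at `F x` to the normal space of `F`. -/
def normalPart (g : (κ → ℝ) → Matrix κ κ ℝ) (F : (ι → ℝ) → (κ → ℝ)) (x : ι → ℝ) (X : κ → ℝ) :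
    κ → ℝ :=
  fun a => X a - ∑ i, ∑ j, (inducedMetric g F x)⁻¹ i j *
    (∑ b, ∑ c, g (F x) b c * X b * tangent F x j c) * tangent F x i a

/-- The ambient covariant derivative of `∂_j F` in the direction of `∂_i F`. -/
def covariantHessian (g : (κ → ℝ) → Matrix κ κ ℝ) (F : (ι → ℝ) → (κ → ℝ)) (x : ι → ℝ) (i j : ι) :
    κ → ℝ :=
  fun a => pd (fun z => tangent F z j a) i x +
    ∑ b, ∑ c, christoffel g (F x) a b c * tangent F x i b * tangent F x j c

/-- The mean curvature vector: the trace, with respect to the induced metric, of the second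
fundamental form `II(∂_i, ∂_j) = (∇_{∂_i F} ∂_j F)^⊥`. -/
def meanCurvatureVector (g : (κ → ℝ) → Matrix κ κ ℝ) (F : (ι → ℝ) → (κ → ℝ)) (x : ι → ℝ) : κ → ℝ :=
  fun a => ∑ i, ∑ j, (inducedMetric g F x)⁻¹ i j * normalPart g F x (covariantHessian g F x i j) a

/-- `F` restricted to `Ω` is a non-degenerate immersion with `H = v^⊥`. -/
def IsTranslator (g : (κ → ℝ) → Matrix κ κ ℝ) (v : κ → ℝ) (Ω : Set (ι → ℝ))
    (F : (ι → ℝ) → (κ → ℝ)) : Prop :=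
  ∀ x ∈ Ω, (inducedMetric g F x).det ≠ 0 ∧ meanCurvatureVector g F x = normalPart g F x v

/-- A hypersurface of a Lorentzian space is time-like if its tangent spaces are non-degenerate and
contain a time-like vector. -/
def IsTimelike (g : (κ → ℝ) → Matrix κ κ ℝ) (Ω : Set (ι → ℝ)) (F : (ι → ℝ) → (κ → ℝ)) : Prop :=
  ∀ x ∈ Ω, (inducedMetric g F x).det ≠ 0 ∧
    ∃ X : ι → ℝ, ∑ i, ∑ j, inducedMetric g F x i j * X i * X j < 0

end Immersions

/-! ### The hyperbolic Einstein static universe `ℍⁿ ×₋₁ ℝ` -/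

section Universe

variable {n : ℕ} [NeZero n]

/-- The half-space model of `ℍⁿ`; the coordinate with index `0` is the positive one. -/
def halfSpace (n : ℕ) [NeZero n] : Set (Fin n → ℝ) :=
  {x | 0 < x 0}

/-- The Lorentzian metric `x₀⁻² (dx₀² + ⋯ + dx_{n-1}²) - dt²`. -/
def metric (n : ℕ) [NeZero n] (y : Fin n ⊕ Unit → ℝ) : Matrix (Fin n ⊕ Unit) (Fin n ⊕ Unit) ℝ :=
  Matrix.diagonal (Sum.elim (fun _ => 1 / (y (Sum.inl 0)) ^ 2) (fun _ => -1))

/-- The vector field `∂_t`. -/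
def timeField (n : ℕ) : Fin n ⊕ Unit → ℝ :=
  Pi.single (Sum.inr ()) 1

/-- The graph map `p ↦ (p, u p)`. -/
def graphMap (u : (Fin n → ℝ) → ℝ) (x : Fin n → ℝ) : Fin n ⊕ Unit → ℝ :=
  Sum.elim x (fun _ => u x)

/-- The horosphere `{x₀ = c}`, for `c > 0`. -/
def horosphere (n : ℕ) [NeZero n] (c : ℝ) : Set (Fin n → ℝ) :=
  {x | x 0 = c}

/-- The graph of `u` over `Ω` is a union of horospheres lying in slices `t = const`. (Any two such
leaves are equal or disjoint.) -/
def FoliatedByHorospheres (Ω : Set (Fin n → ℝ)) (u : (Fin n → ℝ) → ℝ) : Prop :=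
  ∀ p ∈ Ω, ∃ c > 0, p ∈ horosphere n c ∧
    ∀ q ∈ horosphere n c, q ∈ Ω ∧ u q = u p

/-- The signed distance to the horosphere `{x₀ = 1}`, oriented so that `div (∇ρ) = n - 1`. -/
def rho (x : Fin n → ℝ) : ℝ :=
  -Real.log (x 0)

end Universe

/-! ### The profile functions -/

/-- A primitive of `1 / ((1 - x²) (1 - x))`. -/
def P (x : ℝ) : ℝ :=
  -(1 / 4) * Real.log |1 - x| + (1 / 2) * (1 / (1 - x)) + (1 / 4) * Real.log |1 + x|

/-- A primitive of `1 / ((1 - x²) (1 - m x))`, for `m > 1`. -/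
def Q (m x : ℝ) : ℝ :=
  1 / (2 * m - 2) * Real.log |1 - x| + 1 / (2 * m + 2) * Real.log |1 + x|
    - m / (m ^ 2 - 1) * Real.log |1 - m * x|

/-- `G` maps `D` bijectively onto `(-∞, c)`, and `f` is, on the half-line `(-∞, s₀ + c)`, a `C²`
primitive of `s ↦ (G|_D)⁻¹ (s - s₀)`. -/
def IsPrimitiveOfInverse (G : ℝ → ℝ) (D : Set ℝ) (c s₀ : ℝ) (f : ℝ → ℝ) : Prop :=
  BijOn G D (Iio c) ∧ ContDiffOn ℝ 2 f (Iio (s₀ + c)) ∧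
    ∀ s < s₀ + c, HasDerivAt f (Function.invFunOn G D (s - s₀)) s

end HESU

end

/-!
If the graph is foliated by horospheres, then `u = h ∘ ρ`, and the time component of `H = (∂_t)^⊥`
becomes the autonomous equation `y' = (1 - y²) (1 - (n - 1) y)` for the slope `y = h'`. The graph is
time-like exactly where `1 < y²`, so by connectedness `y` stays in one of the rays `(-∞, -1)` and
`(1, ∞)`. Separating variables gives `G (y s) = s - s₀` for a primitive `G` of the reciprocal of the
right-hand side, which is `P` or `Q`. This primitive is monotone on each ray, tends to `-∞` at the
finite end and to the same constant `c` at infinity, so it maps both rays bijectively onto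
`(-∞, c)`, and `h` extends to a primitive of `s ↦ G⁻¹ (s - s₀)` on the half-line `(-∞, s₀ + c)`.
-/

noncomputable section

namespace HESU

open Bornology Filter Topology

/-! ### Bijections onto half-lines and inverse functions -/

section RealAnalysis

theorem bijOn_Ioi_Iio_of_strictMonoOn {α β : Type*}
    [ConditionallyCompleteLinearOrder α] [TopologicalSpace α] [OrderTopology α] [DenselyOrdered α]
    [NoMaxOrder α] [LinearOrder β] [TopologicalSpace β] [OrderClosedTopology β]
    {f : α → β} {a : α} {c : β} (hmono : StrictMonoOn f (Ioi a)) (hcont : ContinuousOn f (Ioi a))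
    (hbot : Tendsto f (𝓝[>] a) atBot) (htop : Tendsto f atTop (𝓝 c)) :
    BijOn f (Ioi a) (Iio c) := by
  have : Nonempty α := ⟨a⟩
  refine ⟨fun x hx => ?_, hmono.injOn, ?_⟩
  · obtain ⟨z, hxz⟩ := exists_gt x
    have hz : z ∈ Ioi a := hx.trans hxz
    have hzc : f z ≤ c := ge_of_tendsto htop <| (eventually_ge_atTop z).mono fun w hw =>
      hmono.monotoneOn hz (hz.trans_le hw) hw
    exact (hmono hx hz hxz).trans_le hzc
  · exact isPreconnected_Ioi.intermediate_value_Iio (le_principal_iff.2 self_mem_nhdsWithin)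
      (le_principal_iff.2 (Ioi_mem_atTop a)) hcont hbot htop

theorem bijOn_Iio_Iio_of_strictAntiOn {α β : Type*}
    [ConditionallyCompleteLinearOrder α] [TopologicalSpace α] [OrderTopology α] [DenselyOrdered α]
    [NoMinOrder α] [LinearOrder β] [TopologicalSpace β] [OrderClosedTopology β]
    {f : α → β} {a : α} {c : β} (hanti : StrictAntiOn f (Iio a)) (hcont : ContinuousOn f (Iio a))
    (hbot : Tendsto f (𝓝[<] a) atBot) (htop : Tendsto f atBot (𝓝 c)) :
    BijOn f (Iio a) (Iio c) :=
  bijOn_Ioi_Iio_of_strictMonoOn (α := αᵒᵈ) hanti.dual_left hcont hbot htop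

theorem mapsTo_Iio_neg_or_mapsTo_Ioi_of_lt_abs {X : Type*} [TopologicalSpace X] {s : Set X}
    {f : X → ℝ} {r : ℝ} (hr : 0 ≤ r) (hs : IsPreconnected s) (hf : ContinuousOn f s)
    (h : ∀ x ∈ s, r < |f x|) : MapsTo f s (Iio (-r)) ∨ MapsTo f s (Ioi r) := by
  have hdisj : Disjoint (Iio (-r)) (Ioi r) :=
    (Iic_disjoint_Ioi (by linarith)).mono_left Iio_subset_Iic_self
  have hsub : f '' s ⊆ Iio (-r) ∪ Ioi r := image_subset_iff.2 fun x hx =>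
    (lt_abs.1 (h x hx)).symm.imp_left lt_neg_of_lt_neg
  exact ((hs.image f hf).subset_or_subset isOpen_Iio isOpen_Ioi hdisj hsub).imp
    image_subset_iff.1 image_subset_iff.1

theorem hasStrictDerivAt_invFunOn {𝕜 : Type*} [NontriviallyNormedField 𝕜] [CompleteSpace 𝕜]
    {f : 𝕜 → 𝕜} {f' x : 𝕜} {D : Set 𝕜} (hf : HasStrictDerivAt f f' x) (hf' : f' ≠ 0)
    (hinj : InjOn f D) (hD : D ∈ 𝓝 x) :
    HasStrictDerivAt (Function.invFunOn f D) f'⁻¹ (f x) :=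
  hf.to_local_left_inverse hf' <| mem_of_superset hD fun _ hz => hinj.leftInvOn_invFunOn hz

theorem exists_forall_hasDerivAt_of_continuousOn {E : Type*} [NormedAddCommGroup E]
    [NormedSpace ℝ E] [CompleteSpace E] {g : ℝ → E} {s : Set ℝ} (hs : IsOpen s)
    (hs' : s.OrdConnected) (hg : ContinuousOn g s) :
    ∃ f : ℝ → E, ∀ x ∈ s, HasDerivAt f (g x) x := by
  rcases s.eq_empty_or_nonempty with rfl | ⟨a, ha⟩
  · simp
  refine ⟨fun x => ∫ t in a..x, g t, fun x hx => intervalIntegral.integral_hasDerivAt_right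
    (hg.mono (hs'.uIcc_subset ha hx)).intervalIntegrable
    (hg.stronglyMeasurableAtFilter hs x hx) (hg.continuousAt (hs.mem_nhds hx))⟩

theorem contDiffOn_succ_of_hasDerivAt {𝕜 E : Type*} [NontriviallyNormedField 𝕜]
    [NormedAddCommGroup E] [NormedSpace 𝕜 E] {f g : 𝕜 → E} {s : Set 𝕜} {k : ℕ} (hs : IsOpen s)
    (hf : ∀ x ∈ s, HasDerivAt f (g x) x) (hg : ContDiffOn 𝕜 k g s) :
    ContDiffOn 𝕜 (k + 1) f s :=
  (contDiffOn_succ_iff_deriv_of_isOpen hs).2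
    ⟨fun x hx => (hf x hx).differentiableAt.differentiableWithinAt, by simp,
      hg.congr fun x hx => (hf x hx).deriv⟩

theorem tendsto_mul_log_add_atBot {k a f' : ℝ} {f r : ℝ → ℝ} (hk : 0 < k)
    (hf : HasDerivAt f f' a) (hf' : f' ≠ 0) (hfa : f a = 0) (hr : ContinuousAt r a) :
    Tendsto (fun x => k * Real.log (f x) + r x) (𝓝[≠] a) atBot := by
  have hlog : Tendsto (fun x => Real.log (f x)) (𝓝[≠] a) atBot :=
    Real.tendsto_log_nhdsNE_zero.comp (hfa ▸ hf.tendsto_nhdsNE hf')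
  exact (hlog.const_mul_atBot hk).atBot_add (hr.tendsto.mono_left nhdsWithin_le_nhds)

theorem tendsto_log_affine_sub_log_cobounded (a : ℝ) {p : ℝ} (hp : p ≠ 0) :
    Tendsto (fun x => Real.log (a + p * x) - Real.log x) (cobounded ℝ) (𝓝 (Real.log p)) := by
  have hlim : Tendsto (fun x : ℝ => a * x⁻¹ + p) (cobounded ℝ) (𝓝 p) := by
    simpa using (tendsto_inv₀_cobounded.const_mul a).add_const p
  refine (hlim.log hp).congr' ?_
  filter_upwards [eventually_ne_cobounded 0, hlim.eventually_ne hp] with x hx hax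
  rw [eq_sub_iff_add_eq, ← Real.log_mul hax hx, add_mul, inv_mul_cancel_right₀ hx]

end RealAnalysis

/-! ### Separation of variables -/

section Separation

variable {G h v y : ℝ → ℝ} {D I : Set ℝ} {c s₀ : ℝ}

theorem exists_eq_sub_of_autonomous (hI : IsOpen I) (hIc : IsPreconnected I)
    (hG : ∀ s ∈ I, HasDerivAt G (v (y s))⁻¹ (y s)) (hv : ∀ s ∈ I, v (y s) ≠ 0)
    (hy : ∀ s ∈ I, HasDerivAt y (v (y s)) s) : ∃ s₀, ∀ s ∈ I, G (y s) = s - s₀ := by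
  have hGy : ∀ s ∈ I, HasDerivAt (fun s => G (y s)) 1 s := fun s hs =>
    ((hG s hs).comp s (hy s hs)).congr_deriv (inv_mul_cancel₀ (hv s hs))
  obtain ⟨a, ha⟩ := hI.exists_eq_add_of_deriv_eq hIc (g := id)
    (fun s hs => (hGy s hs).differentiableAt.differentiableWithinAt) differentiableOn_id
    fun s hs => by rw [(hGy s hs).deriv, deriv_id]
  exact ⟨-a, fun s hs => by simpa using ha hs⟩

theorem exists_isPrimitiveOfInverse (hbij : BijOn G D (Iio c)) (hD : IsOpen D)
    (hG : ∀ x ∈ D, HasStrictDerivAt G (v x)⁻¹ x) (hv : ∀ x ∈ D, v x ≠ 0)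
    (hvc : ContinuousOn v D) (s₀ : ℝ) : ∃ f, IsPrimitiveOfInverse G D c s₀ f := by
  set g : ℝ → ℝ := fun s => Function.invFunOn G D (s - s₀)
  have hshift : MapsTo (· - s₀) (Iio (s₀ + c)) (Iio c) := fun s hs =>
    mem_Iio.2 (sub_lt_iff_lt_add'.2 hs)
  have hgD : MapsTo g (Iio (s₀ + c)) D := hbij.surjOn.mapsTo_invFunOn.comp hshift
  have hg : ∀ s ∈ Iio (s₀ + c), HasDerivAt g (v (g s)) s := fun s hs => by
    have hinv := (hasStrictDerivAt_invFunOn (hG _ (hgD hs)) (inv_ne_zero (hv _ (hgD hs)))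
      hbij.injOn (hD.mem_nhds (hgD hs))).hasDerivAt
    rw [inv_inv, hbij.surjOn.rightInvOn_invFunOn (hshift hs)] at hinv
    exact hinv.comp_sub_const s s₀
  have hgc : ContinuousOn g (Iio (s₀ + c)) := HasDerivAt.continuousOn hg
  have hg1 : ContDiffOn ℝ 1 g (Iio (s₀ + c)) := by
    simpa using contDiffOn_succ_of_hasDerivAt (k := 0) isOpen_Iio hg
      (contDiffOn_zero.2 (hvc.comp hgc hgD))
  obtain ⟨f, hf⟩ := exists_forall_hasDerivAt_of_continuousOn isOpen_Iio ordConnected_Iio hgc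
  exact ⟨f, hbij, contDiffOn_succ_of_hasDerivAt (k := 1) isOpen_Iio hf hg1, hf⟩

theorem IsPrimitiveOfInverse.add_const {f : ℝ → ℝ} (hf : IsPrimitiveOfInverse G D c s₀ f)
    (a : ℝ) : IsPrimitiveOfInverse G D c s₀ (f · + a) :=
  ⟨hf.1, hf.2.1.add contDiffOn_const, fun s hs => (hf.2.2 s hs).add_const a⟩

theorem exists_isPrimitiveOfInverse_eqOn_of_bijOn (hbij : BijOn G D (Iio c)) (hD : IsOpen D)
    (hG : ∀ x ∈ D, HasStrictDerivAt G (v x)⁻¹ x) (hv : ∀ x ∈ D, v x ≠ 0)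
    (hvc : ContinuousOn v D) (hI : IsOpen I) (hIc : IsPreconnected I)
    (hh : ∀ s ∈ I, HasDerivAt h (y s) s) (hy : ∀ s ∈ I, HasDerivAt y (v (y s)) s)
    (hyD : MapsTo y I D) :
    ∃ f s₀, I ⊆ Iio (s₀ + c) ∧ EqOn h f I ∧ IsPrimitiveOfInverse G D c s₀ f := by
  obtain ⟨s₀, hs₀⟩ := exists_eq_sub_of_autonomous hI hIc
    (fun s hs => (hG _ (hyD hs)).hasDerivAt) (fun s hs => hv _ (hyD hs)) hy
  have hIs : I ⊆ Iio (s₀ + c) := fun s hs => by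
    have hlt : G (y s) < c := hbij.mapsTo (hyD hs)
    rw [hs₀ s hs] at hlt
    exact sub_lt_iff_lt_add'.1 hlt
  obtain ⟨f, hf⟩ := exists_isPrimitiveOfInverse hbij hD hG hv hvc s₀
  have hfy : ∀ s ∈ I, HasDerivAt f (y s) s := fun s hs => by
    have hinv : Function.invFunOn G D (s - s₀) = y s := by
      rw [← hs₀ s hs]
      exact hbij.injOn.leftInvOn_invFunOn (hyD hs)
    exact hinv ▸ hf.2.2 s (hIs hs)
  obtain ⟨a, ha⟩ := hI.exists_eq_add_of_deriv_eq hIc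
    (fun s hs => (hh s hs).differentiableAt.differentiableWithinAt)
    (fun s hs => (hfy s hs).differentiableAt.differentiableWithinAt)
    fun s hs => (hh s hs).deriv.trans (hfy s hs).deriv.symm
  exact ⟨(f · + a), s₀, hIs, ha, hf.add_const a⟩

end Separation

/-! ### The slope equation and its time maps -/

section TimeMap

/-- The right-hand side of the autonomous equation `y' = (1 - y²) (1 - m y)` satisfied by the slope
`y = h'` of a translator `u = h ∘ ρ`, where `m = n - 1`. -/
def slopeField (m x : ℝ) : ℝ :=
  (1 - x ^ 2) * (1 - m * x)

/-- `G` is a time map of `y' = slopeField m y` in the time-like range `1 < |y|`: a primitive of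
`1 / slopeField m`, so that the solutions are given by `G (y s) = s - s₀`. It tends to `-∞` at the
two ends `±1` of this range, and to `c` at infinity. -/
structure IsTimeMap (m c : ℝ) (G : ℝ → ℝ) : Prop where
  hasStrictDerivAt : ∀ x, 1 < |x| → HasStrictDerivAt G (slopeField m x)⁻¹ x
  tendsto_nhdsLT_neg_one : Tendsto G (𝓝[<] (-1)) atBot
  tendsto_nhdsGT_one : Tendsto G (𝓝[>] 1) atBot
  tendsto_cobounded : Tendsto G (cobounded ℝ) (𝓝 c)

variable {m c x : ℝ} {G : ℝ → ℝ}

theorem continuous_slopeField (m : ℝ) : Continuous (slopeField m) := by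
  unfold slopeField
  fun_prop

theorem slopeField_pos (hm : 1 ≤ m) (hx : 1 < x) : 0 < slopeField m x :=
  mul_pos_of_neg_of_neg (by nlinarith) (by nlinarith)

theorem slopeField_neg (hm : 0 ≤ m) (hx : x < -1) : slopeField m x < 0 :=
  mul_neg_of_neg_of_pos (by nlinarith) (by nlinarith)

theorem IsTimeMap.bijOn_Ioi (hG : IsTimeMap m c G) (hm : 1 ≤ m) : BijOn G (Ioi 1) (Iio c) := by
  have hderiv : ∀ x ∈ Ioi (1 : ℝ), HasDerivAt G (slopeField m x)⁻¹ x := fun x hx =>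
    (hG.hasStrictDerivAt x (lt_abs.2 (.inl hx))).hasDerivAt
  have hcont : ContinuousOn G (Ioi 1) := HasDerivAt.continuousOn hderiv
  refine bijOn_Ioi_Iio_of_strictMonoOn ?_ hcont hG.tendsto_nhdsGT_one
    (hG.tendsto_cobounded.mono_left IsOrderBornology.atTop_le_cobounded)
  refine strictMonoOn_of_deriv_pos (convex_Ioi 1) hcont fun x hx => ?_
  rw [interior_Ioi] at hx
  rw [(hderiv x hx).deriv]
  exact inv_pos.2 (slopeField_pos hm hx)

theorem IsTimeMap.bijOn_Iio (hG : IsTimeMap m c G) (hm : 0 ≤ m) :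
    BijOn G (Iio (-1)) (Iio c) := by
  have hderiv : ∀ x ∈ Iio (-1 : ℝ), HasDerivAt G (slopeField m x)⁻¹ x := fun x hx =>
    (hG.hasStrictDerivAt x (lt_abs.2 (.inr (lt_neg_of_lt_neg hx)))).hasDerivAt
  have hcont : ContinuousOn G (Iio (-1)) := HasDerivAt.continuousOn hderiv
  refine bijOn_Iio_Iio_of_strictAntiOn ?_ hcont hG.tendsto_nhdsLT_neg_one
    (hG.tendsto_cobounded.mono_left IsOrderBornology.atBot_le_cobounded)
  refine strictAntiOn_of_deriv_neg (convex_Iio (-1)) hcont fun x hx => ?_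
  rw [interior_Iio] at hx
  rw [(hderiv x hx).deriv]
  exact inv_lt_zero.2 (slopeField_neg hm hx)

theorem IsTimeMap.exists_isPrimitiveOfInverse_eqOn (hG : IsTimeMap m c G) (hm : 1 ≤ m)
    {I : Set ℝ} (hI : IsOpen I) (hIc : IsPreconnected I) {h y : ℝ → ℝ}
    (hh : ∀ s ∈ I, HasDerivAt h (y s) s) (hy : ∀ s ∈ I, HasDerivAt y (slopeField m (y s)) s)
    (hy1 : ∀ s ∈ I, 1 < |y s|) :
    ∃ f s₀, I ⊆ Iio (s₀ + c) ∧ EqOn h f I ∧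
      (IsPrimitiveOfInverse G (Iio (-1)) c s₀ f ∨ IsPrimitiveOfInverse G (Ioi 1) c s₀ f) := by
  rcases mapsTo_Iio_neg_or_mapsTo_Ioi_of_lt_abs zero_le_one hIc (HasDerivAt.continuousOn hy) hy1
    with hyD | hyD
  · obtain ⟨f, s₀, hIs, hhf, hf⟩ := exists_isPrimitiveOfInverse_eqOn_of_bijOn
      (hG.bijOn_Iio (zero_le_one.trans hm)) isOpen_Iio
      (fun x hx => hG.hasStrictDerivAt x (lt_abs.2 (.inr (lt_neg_of_lt_neg hx))))
      (fun x hx => (slopeField_neg (zero_le_one.trans hm) hx).ne)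
      (continuous_slopeField m).continuousOn hI hIc hh hy hyD
    exact ⟨f, s₀, hIs, hhf, .inl hf⟩
  · obtain ⟨f, s₀, hIs, hhf, hf⟩ := exists_isPrimitiveOfInverse_eqOn_of_bijOn
      (hG.bijOn_Ioi hm) isOpen_Ioi (fun x hx => hG.hasStrictDerivAt x (lt_abs.2 (.inl hx)))
      (fun x hx => (slopeField_pos hm hx).ne')
      (continuous_slopeField m).continuousOn hI hIc hh hy hyD
    exact ⟨f, s₀, hIs, hhf, .inr hf⟩

theorem one_sub_ne_zero_and_one_add_ne_zero (hx : 1 < |x|) : 1 - x ≠ 0 ∧ 1 + x ≠ 0 := by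
  constructor <;> intro h
  · simp [show x = 1 by linarith] at hx
  · simp [show x = -1 by linarith] at hx

theorem one_sub_mul_ne_zero (hm : 1 ≤ |m|) (hx : 1 < |x|) : 1 - m * x ≠ 0 := fun h => by
  have h1 : |m| * |x| = 1 := by rw [← abs_mul, ← sub_eq_zero.1 h, abs_one]
  nlinarith

theorem P_eq (x : ℝ) :
    P x = -(1 / 4) * Real.log (1 - x) + 1 / 2 * (1 - x)⁻¹ + 1 / 4 * Real.log (1 + x) := by
  simp only [P, Real.log_abs, one_div (1 - x)]

theorem Q_eq (m x : ℝ) : Q m x = 1 / (2 * m - 2) * Real.log (1 - x) +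
    1 / (2 * m + 2) * Real.log (1 + x) - m / (m ^ 2 - 1) * Real.log (1 - m * x) := by
  simp only [Q, Real.log_abs]

theorem hasStrictDerivAt_P (hx : 1 - x ≠ 0) (hx' : 1 + x ≠ 0) :
    HasStrictDerivAt P (slopeField 1 x)⁻¹ x := by
  have hsub : HasStrictDerivAt (fun x : ℝ => 1 - x) (-1) x := (hasStrictDerivAt_id x).const_sub 1
  have hadd : HasStrictDerivAt (fun x : ℝ => 1 + x) 1 x := (hasStrictDerivAt_id x).const_add 1
  rw [funext P_eq]
  refine ((((hsub.log hx).const_mul _).add (((hasStrictDerivAt_inv hx).comp x hsub).const_mul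
    _)).add ((hadd.log hx').const_mul _)).congr_deriv ?_
  rw [slopeField, show 1 - x ^ 2 = (1 - x) * (1 + x) by ring, one_mul]
  field_simp
  ring

theorem hasStrictDerivAt_Q (hm : m - 1 ≠ 0) (hm' : m + 1 ≠ 0) (hx : 1 - x ≠ 0) (hx' : 1 + x ≠ 0)
    (hmx : 1 - m * x ≠ 0) : HasStrictDerivAt (Q m) (slopeField m x)⁻¹ x := by
  have hsub : HasStrictDerivAt (fun x : ℝ => 1 - x) (-1) x := (hasStrictDerivAt_id x).const_sub 1
  have hadd : HasStrictDerivAt (fun x : ℝ => 1 + x) 1 x := (hasStrictDerivAt_id x).const_add 1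
  have hmul : HasStrictDerivAt (fun x : ℝ => 1 - m * x) (-(m * 1)) x :=
    ((hasStrictDerivAt_id x).const_mul m).const_sub 1
  rw [funext (Q_eq m)]
  refine ((((hsub.log hx).const_mul _).add ((hadd.log hx').const_mul _)).sub
    ((hmul.log hmx).const_mul _)).congr_deriv ?_
  rw [slopeField, show 1 - x ^ 2 = (1 - x) * (1 + x) by ring,
    show m ^ 2 - 1 = (m - 1) * (m + 1) by ring, show 2 * m - 2 = 2 * (m - 1) by ring,
    show 2 * m + 2 = 2 * (m + 1) by ring]
  field_simp
  ring

theorem tendsto_P_nhdsNE_neg_one : Tendsto P (𝓝[≠] (-1)) atBot := by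
  have hreg : ContinuousAt (fun x : ℝ => -(1 / 4) * Real.log (1 - x) + 1 / 2 * (1 - x)⁻¹) (-1) := by
    have : (1 : ℝ) - -1 ≠ 0 := by norm_num
    fun_prop (disch := assumption)
  refine (tendsto_mul_log_add_atBot (by norm_num : (0 : ℝ) < 1 / 4)
    ((hasDerivAt_id _).const_add 1) one_ne_zero (by simp) hreg).congr fun x => ?_
  rw [P_eq, id, add_comm]

theorem tendsto_P_nhdsGT_one : Tendsto P (𝓝[>] 1) atBot := by
  have hsub : Tendsto (fun x : ℝ => 1 - x) (𝓝[>] 1) (𝓝[<] 0) := by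
    refine tendsto_nhdsWithin_iff.2 ⟨?_, ?_⟩
    · exact (Continuous.tendsto' (by fun_prop) 1 0 (by norm_num)).mono_left nhdsWithin_le_nhds
    · filter_upwards [self_mem_nhdsWithin] with x hx using sub_neg.2 (mem_Ioi.1 hx)
  have hfactor : Tendsto (fun x : ℝ => -(1 / 4) * (Real.log (1 - x) * (1 - x)) + 1 / 2) (𝓝[>] 1)
      (𝓝 (-(1 / 4) * 0 + 1 / 2)) :=
    ((tendsto_log_mul_self_nhdsLT_zero.comp hsub).const_mul _).add_const _
  have hreg : ContinuousAt (fun x : ℝ => 1 / 4 * Real.log (1 + x)) 1 := by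
    have : (1 : ℝ) + 1 ≠ 0 := by norm_num
    fun_prop (disch := assumption)
  -- The pole `1 / (1 - x)` dominates `log (1 - x)`, which has the opposite sign.
  have hpole := (tendsto_inv_nhdsLT_zero.comp hsub).atBot_mul_pos (by norm_num) hfactor
  refine ((hreg.tendsto.mono_left nhdsWithin_le_nhds).add_atBot hpole).congr' ?_
  filter_upwards [self_mem_nhdsWithin] with x hx
  have hx0 : 1 - x ≠ 0 := (sub_neg.2 (mem_Ioi.1 hx)).ne
  simp only [P_eq, Function.comp_apply]
  field_simp
  ring

theorem tendsto_P_cobounded : Tendsto P (cobounded ℝ) (𝓝 0) := by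
  have hsub := (tendsto_log_affine_sub_log_cobounded 1 (p := -1) (by norm_num)).const_mul
    (-(1 / 4) : ℝ)
  have hadd := (tendsto_log_affine_sub_log_cobounded 1 one_ne_zero).const_mul (1 / 4 : ℝ)
  have hinv : Tendsto (fun x : ℝ => 1 / 2 * (1 - x)⁻¹) (cobounded ℝ) (𝓝 (1 / 2 * 0)) :=
    (tendsto_inv₀_cobounded.comp (tendsto_const_sub_cobounded 1)).const_mul _
  have hsum := (hsub.add hinv).add hadd
  simp only [Real.log_neg_eq_log, Real.log_one, mul_zero, add_zero] at hsum
  refine hsum.congr fun x => ?_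
  rw [P_eq, neg_one_mul, ← sub_eq_add_neg, one_mul]
  ring

theorem isTimeMap_P : IsTimeMap 1 0 P where
  hasStrictDerivAt _ hx :=
    have hx' := one_sub_ne_zero_and_one_add_ne_zero hx
    hasStrictDerivAt_P hx'.1 hx'.2
  tendsto_nhdsLT_neg_one := tendsto_P_nhdsNE_neg_one.mono_left (nhdsLT_le_nhdsNE _)
  tendsto_nhdsGT_one := tendsto_P_nhdsGT_one
  tendsto_cobounded := tendsto_P_cobounded

theorem tendsto_Q_nhdsNE_neg_one (hm : -1 < m) : Tendsto (Q m) (𝓝[≠] (-1)) atBot := by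
  have hreg : ContinuousAt (fun x : ℝ => 1 / (2 * m - 2) * Real.log (1 - x)
      - m / (m ^ 2 - 1) * Real.log (1 - m * x)) (-1) := by
    have : (1 : ℝ) - -1 ≠ 0 := by norm_num
    have : (1 : ℝ) - m * -1 ≠ 0 := by linarith
    fun_prop (disch := assumption)
  refine (tendsto_mul_log_add_atBot (one_div_pos.2 (by linarith : 0 < 2 * m + 2))
    ((hasDerivAt_id _).const_add 1) one_ne_zero (by simp) hreg).congr fun x => ?_
  rw [Q_eq, id]
  ring

theorem tendsto_Q_nhdsNE_one (hm : 1 < m) : Tendsto (Q m) (𝓝[≠] 1) atBot := by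
  have hreg : ContinuousAt (fun x : ℝ => 1 / (2 * m + 2) * Real.log (1 + x)
      - m / (m ^ 2 - 1) * Real.log (1 - m * x)) 1 := by
    have : (1 : ℝ) + 1 ≠ 0 := by norm_num
    have : (1 : ℝ) - m * 1 ≠ 0 := by linarith
    fun_prop (disch := assumption)
  refine (tendsto_mul_log_add_atBot (one_div_pos.2 (by linarith : 0 < 2 * m - 2))
    ((hasDerivAt_id _).const_sub 1) (by norm_num) (by simp) hreg).congr fun x => ?_
  rw [Q_eq, id]
  ring

theorem tendsto_Q_cobounded (hm : m ≠ 0) (hm1 : m - 1 ≠ 0) (hm1' : m + 1 ≠ 0) :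
    Tendsto (Q m) (cobounded ℝ) (𝓝 (m / (1 - m ^ 2) * Real.log m)) := by
  have hsub := (tendsto_log_affine_sub_log_cobounded 1 (p := -1) (by norm_num)).const_mul
    (1 / (2 * m - 2))
  have hadd := (tendsto_log_affine_sub_log_cobounded 1 one_ne_zero).const_mul (1 / (2 * m + 2))
  have hmul := (tendsto_log_affine_sub_log_cobounded 1 (neg_ne_zero.2 hm)).const_mul
    (m / (m ^ 2 - 1))
  -- The coefficients of the three logarithms add up to zero, so the terms `log x` cancel.
  have hcoeff : 1 / (2 * m - 2) + 1 / (2 * m + 2) - m / (m ^ 2 - 1) = 0 := by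
    rw [show m ^ 2 - 1 = (m - 1) * (m + 1) by ring, show 2 * m - 2 = 2 * (m - 1) by ring,
      show 2 * m + 2 = 2 * (m + 1) by ring]
    field_simp
    ring
  have hlim : m / (1 - m ^ 2) * Real.log m = 0 + 0 - m / (m ^ 2 - 1) * Real.log m := by
    rw [← neg_sub (m ^ 2) 1, div_neg]
    ring
  have hsum := (hsub.add hadd).sub hmul
  simp only [Real.log_neg_eq_log, Real.log_one, mul_zero] at hsum
  rw [hlim]
  refine hsum.congr fun x => ?_
  rw [Q_eq, neg_one_mul, ← sub_eq_add_neg, one_mul, neg_mul, ← sub_eq_add_neg]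
  linear_combination -Real.log x * hcoeff

theorem isTimeMap_Q (hm : 1 < m) : IsTimeMap m (m / (1 - m ^ 2) * Real.log m) (Q m) where
  hasStrictDerivAt _ hx :=
    have hx' := one_sub_ne_zero_and_one_add_ne_zero hx
    hasStrictDerivAt_Q (by linarith) (by linarith) hx'.1 hx'.2
      (one_sub_mul_ne_zero (hm.le.trans (le_abs_self m)) hx)
  tendsto_nhdsLT_neg_one :=
    (tendsto_Q_nhdsNE_neg_one (by linarith)).mono_left (nhdsLT_le_nhdsNE _)
  tendsto_nhdsGT_one := (tendsto_Q_nhdsNE_one hm).mono_left (nhdsGT_le_nhdsNE _)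
  tendsto_cobounded := tendsto_Q_cobounded (by linarith) (by linarith) (by linarith)

end TimeMap

/-! ### Locality of the translator equation -/

section Locality

variable {ι κ : Type*} [DecidableEq ι]

theorem pd_congr {φ ψ : (ι → ℝ) → ℝ} {x : ι → ℝ} (h : φ =ᶠ[𝓝 x] ψ) (i : ι) :
    pd φ i x = pd ψ i x := by
  rw [pd, pd, h.fderiv_eq]

variable {F F' : (ι → ℝ) → (κ → ℝ)} {x : ι → ℝ} {Ω : Set (ι → ℝ)}

theorem tangent_congr (h : F =ᶠ[𝓝 x] F') : tangent F x = tangent F' x := by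
  funext i a
  exact pd_congr (h.fun_comp (· a)) i

variable [Fintype κ] {g : (κ → ℝ) → Matrix κ κ ℝ} {v : κ → ℝ}

theorem inducedMetric_congr (h : F =ᶠ[𝓝 x] F') : inducedMetric g F x = inducedMetric g F' x := by
  unfold inducedMetric
  rw [tangent_congr h, h.eq_of_nhds]

theorem covariantHessian_congr [DecidableEq κ] (h : F =ᶠ[𝓝 x] F') :
    covariantHessian g F x = covariantHessian g F' x := by
  funext i j a
  have hpd : pd (fun z => tangent F z j a) i x = pd (fun z => tangent F' z j a) i x :=
    pd_congr (h.eventuallyEq_nhds.mono fun z hz => by rw [tangent_congr hz]) i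
  rw [covariantHessian, covariantHessian, hpd, tangent_congr h, h.eq_of_nhds]

variable [Fintype ι]

theorem normalPart_congr (h : F =ᶠ[𝓝 x] F') : normalPart g F x = normalPart g F' x := by
  unfold normalPart
  rw [inducedMetric_congr h, tangent_congr h, h.eq_of_nhds]

theorem IsTimelike.congr (hF : IsTimelike g Ω F) (hΩ : IsOpen Ω) (h : EqOn F F' Ω) :
    IsTimelike g Ω F' := fun x hx => by
  rw [← inducedMetric_congr (h.eventuallyEq_of_mem (hΩ.mem_nhds hx))]
  exact hF x hx

variable [DecidableEq κ]

theorem meanCurvatureVector_congr (h : F =ᶠ[𝓝 x] F') :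
    meanCurvatureVector g F x = meanCurvatureVector g F' x := by
  unfold meanCurvatureVector
  rw [inducedMetric_congr h, normalPart_congr h, covariantHessian_congr h]

theorem IsTranslator.congr (hF : IsTranslator g v Ω F) (hΩ : IsOpen Ω) (h : EqOn F F' Ω) :
    IsTranslator g v Ω F' := fun x hx => by
  have hx' := h.eventuallyEq_of_mem (hΩ.mem_nhds hx)
  rw [← inducedMetric_congr hx', ← meanCurvatureVector_congr hx', ← normalPart_congr hx']
  exact hF x hx

end Locality

/-! ### Graphs of functions of the distance to a horosphere -/

section Geometry

theorem pd_const {ι : Type*} [DecidableEq ι] (a : ℝ) (x : ι → ℝ) (i : ι) :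
    pd (fun _ => a) i x = 0 := by
  simp [pd]

theorem pd_comp_apply {ι : Type*} [Finite ι] [DecidableEq ι] {ψ : ℝ → ℝ} {ψ' : ℝ} {x : ι → ℝ}
    {k : ι} (h : HasDerivAt ψ ψ' (x k)) (i : ι) :
    pd (fun z => ψ (z k)) i x = if i = k then ψ' else 0 := by
  cases nonempty_fintype ι
  have hproj : HasFDerivAt (fun z : ι → ℝ => z k) (ContinuousLinearMap.proj (R := ℝ) k) x :=
    hasFDerivAt_apply k x
  have hcomp := h.comp_hasFDerivAt x hproj
  rw [pd, show (fun z : ι → ℝ => ψ (z k)) = ψ ∘ fun z => z k from rfl, hcomp.fderiv]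
  simp [Pi.single_apply, eq_comm]

theorem tangent_graphMap_inl {n : ℕ} (u : (Fin n → ℝ) → ℝ) (x : Fin n → ℝ) (i k : Fin n) :
    tangent (graphMap u) x i (.inl k) = if i = k then 1 else 0 :=
  pd_comp_apply (hasDerivAt_id _) i

variable {n : ℕ} [NeZero n]

theorem inv_metric {y : Fin n ⊕ Unit → ℝ} (hy : y (.inl 0) ≠ 0) :
    (metric n y)⁻¹ = Matrix.diagonal (Sum.elim (fun _ => y (.inl 0) ^ 2) fun _ => -1) := by
  refine Matrix.inv_eq_left_inv ?_
  rw [metric, Matrix.diagonal_mul_diagonal, ← Matrix.diagonal_one]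
  congr 1
  ext (i | i) <;> simp [hy]

theorem pd_metric {y : Fin n ⊕ Unit → ℝ} (hy : y (.inl 0) ≠ 0) (a b d : Fin n ⊕ Unit) :
    pd (fun z => metric n z a b) d y = if d = .inl 0 then
      Matrix.diagonal (Sum.elim (fun _ => -2 / y (.inl 0) ^ 3) fun _ => 0) a b else 0 := by
  rcases eq_or_ne a b with rfl | hab
  · rcases a with k | k
    · have hderiv : HasDerivAt (fun r : ℝ => 1 / r ^ 2) (-2 / y (.inl 0) ^ 3) (y (.inl 0)) := by
        simp only [one_div]
        refine ((hasDerivAt_pow 2 (y (.inl 0))).fun_inv (pow_ne_zero 2 hy)).congr_deriv ?_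
        field_simp
        norm_num [mul_comm]
      simpa only [metric, Matrix.diagonal_apply_eq, Sum.elim_inl] using pd_comp_apply hderiv d
    · simp [metric, pd_const]
  · simp [metric, pd_const, hab]

theorem christoffel_metric_time {y : Fin n ⊕ Unit → ℝ} (hy : y (.inl 0) ≠ 0)
    (b c : Fin n ⊕ Unit) : christoffel (metric n) y (.inr ()) b c = 0 := by
  simp [christoffel, pd_metric hy, inv_metric hy, Matrix.diagonal_apply]

theorem christoffel_metric_height {y : Fin n ⊕ Unit → ℝ} (hy : y (.inl 0) ≠ 0)
    (b c : Fin n ⊕ Unit) : christoffel (metric n) y (.inl 0) b c =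
      Matrix.diagonal (Sum.elim (fun i => (if i = 0 then -1 else 1) / y (.inl 0)) fun _ => 0)
        b c := by
  have hsum : christoffel (metric n) y (.inl 0) b c =
      1 / 2 * (y (.inl 0) ^ 2 * (pd (fun z => metric n z (.inl 0) c) b y +
        pd (fun z => metric n z (.inl 0) b) c y - pd (fun z => metric n z b c) (.inl 0) y)) := by
    simp [christoffel, inv_metric hy, Matrix.diagonal_apply]
  simp only [hsum, pd_metric hy, Matrix.diagonal_apply]
  rcases b with b | b <;> rcases c with c | c
  · rcases eq_or_ne b c with rfl | hbc
    · rcases eq_or_ne b 0 with rfl | hb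
      · simp only [if_true, Sum.elim_inl, add_sub_cancel_right]
        field_simp
      · simp only [Sum.inl.injEq, hb, if_false, if_true, Sum.elim_inl, add_zero, zero_sub]
        field_simp
    · rcases eq_or_ne b 0 with rfl | hb
      · simp [hbc, hbc.symm]
      · simp [hbc, hb, hb.symm]
  all_goals simp

theorem inducedMetric_graphMap (u : (Fin n → ℝ) → ℝ) (x : Fin n → ℝ) (i j : Fin n) :
    inducedMetric (metric n) (graphMap u) x i j = (if i = j then 1 / x 0 ^ 2 else 0) -
      tangent (graphMap u) x i (.inr ()) * tangent (graphMap u) x j (.inr ()) := by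
  simp [inducedMetric, metric, Matrix.diagonal_apply, tangent_graphMap_inl, graphMap,
    ← sub_eq_add_neg]

theorem covariantHessian_graphMap_height (u : (Fin n → ℝ) → ℝ) {x : Fin n → ℝ} (hx : x 0 ≠ 0)
    (i : Fin n) : covariantHessian (metric n) (graphMap u) x i i (.inl 0) =
      (if i = 0 then -1 else 1) / x 0 := by
  have hy : graphMap u x (.inl 0) ≠ 0 := hx
  simp only [covariantHessian, christoffel_metric_height hy, Fintype.sum_sum_type,
    Matrix.diagonal_apply, tangent_graphMap_inl, pd_const]
  simp [graphMap]

variable {h y : ℝ → ℝ} {a y' : ℝ} {x : Fin n → ℝ}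

theorem tangent_graphMap_comp_rho_inr (hx : x 0 ≠ 0) (hh : HasDerivAt h a (rho x)) (i : Fin n) :
    tangent (graphMap (h ∘ rho)) x i (.inr ()) = if i = 0 then -a / x 0 else 0 := by
  have hderiv : HasDerivAt (fun r => h (-Real.log r)) (-a / x 0) (x 0) :=
    (hh.comp (x 0) (Real.hasDerivAt_log hx).neg).congr_deriv (by ring)
  exact pd_comp_apply hderiv i

theorem inducedMetric_graphMap_comp_rho (hx : x 0 ≠ 0) (hh : HasDerivAt h a (rho x)) :
    inducedMetric (metric n) (graphMap (h ∘ rho)) x =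
      Matrix.diagonal fun i => (if i = 0 then 1 - a ^ 2 else 1) / x 0 ^ 2 := by
  ext i j
  rw [inducedMetric_graphMap, tangent_graphMap_comp_rho_inr hx hh,
    tangent_graphMap_comp_rho_inr hx hh, Matrix.diagonal_apply]
  rcases eq_or_ne i j with rfl | hij
  · simp only [if_true]
    split_ifs <;> ring
  · rcases eq_or_ne i 0 with rfl | hi
    · simp [hij, hij.symm]
    · simp [hi, hij]

theorem inv_inducedMetric_graphMap_comp_rho (hx : x 0 ≠ 0) (hh : HasDerivAt h a (rho x))
    (ha : 1 - a ^ 2 ≠ 0) : (inducedMetric (metric n) (graphMap (h ∘ rho)) x)⁻¹ =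
      Matrix.diagonal fun i => x 0 ^ 2 / (if i = 0 then 1 - a ^ 2 else 1) := by
  refine Matrix.inv_eq_left_inv ?_
  rw [inducedMetric_graphMap_comp_rho hx hh, Matrix.diagonal_mul_diagonal, ← Matrix.diagonal_one]
  congr 1
  ext i
  split_ifs <;> field_simp

theorem normalPart_graphMap_comp_rho_time (hx : x 0 ≠ 0) (hh : HasDerivAt h a (rho x))
    (ha : 1 - a ^ 2 ≠ 0) (X : Fin n ⊕ Unit → ℝ) :
    normalPart (metric n) (graphMap (h ∘ rho)) x X (.inr ()) =
      (X (.inr ()) + a * X (.inl 0) / x 0) / (1 - a ^ 2) := by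
  have hsum : normalPart (metric n) (graphMap (h ∘ rho)) x X (.inr ()) =
      X (.inr ()) - x 0 ^ 2 / (1 - a ^ 2) *
        ((x 0 ^ 2)⁻¹ * X (.inl 0) + -(X (.inr ()) * (-a / x 0))) * (-a / x 0) := by
    simp [normalPart, inv_inducedMetric_graphMap_comp_rho hx hh ha, metric,
      Matrix.diagonal_apply, tangent_graphMap_inl, tangent_graphMap_comp_rho_inr hx hh, graphMap]
  rw [hsum]
  field_simp
  ring

theorem covariantHessian_graphMap_comp_rho_time (hx : x 0 ≠ 0)
    (hh : ∀ᶠ s in 𝓝 (rho x), HasDerivAt h (y s) s) (hy : HasDerivAt y y' (rho x)) (i : Fin n) :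
    covariantHessian (metric n) (graphMap (h ∘ rho)) x i i (.inr ()) =
      if i = 0 then (y' + y (rho x)) / x 0 ^ 2 else 0 := by
  have hx' : graphMap (h ∘ rho) x (.inl 0) ≠ 0 := hx
  have hx0 : ContinuousAt (fun z : Fin n → ℝ => z 0) x := continuousAt_apply 0 x
  have htangent : (fun z => tangent (graphMap (h ∘ rho)) z i (.inr ())) =ᶠ[𝓝 x]
      fun z => if i = 0 then -y (-Real.log (z 0)) / z 0 else 0 := by
    filter_upwards [hx0.eventually_ne hx, (hx0.log hx).neg.eventually hh] with z hz hhz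
    exact tangent_graphMap_comp_rho_inr hz hhz i
  have hderiv : HasDerivAt (fun r => -y (-Real.log r) / r) ((y' + y (rho x)) / x 0 ^ 2) (x 0) := by
    refine ((hy.comp (x 0) (Real.hasDerivAt_log hx).neg).neg.div
      (hasDerivAt_id (x 0)) hx).congr_deriv ?_
    simp only [rho, Pi.neg_apply, Function.comp_apply, id_eq]
    field_simp
    ring
  simp only [covariantHessian, christoffel_metric_time hx', zero_mul, Finset.sum_const_zero,
    add_zero, pd_congr htangent]
  split_ifs with hi
  · rw [pd_comp_apply hderiv, if_pos hi]
  · exact pd_const 0 x i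

theorem meanCurvatureVector_graphMap_comp_rho_time (hx : x 0 ≠ 0)
    (hh : ∀ᶠ s in 𝓝 (rho x), HasDerivAt h (y s) s) (hy : HasDerivAt y y' (rho x))
    (hne : 1 - y (rho x) ^ 2 ≠ 0) :
    meanCurvatureVector (metric n) (graphMap (h ∘ rho)) x (.inr ()) =
      y' / (1 - y (rho x) ^ 2) ^ 2 + (n - 1) * y (rho x) / (1 - y (rho x) ^ 2) := by
  obtain ⟨m, rfl⟩ := Nat.exists_eq_succ_of_ne_zero (NeZero.ne n)
  have hhx := hh.self_of_nhds
  simp only [meanCurvatureVector, inv_inducedMetric_graphMap_comp_rho hx hhx hne,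
    Matrix.diagonal_apply, ite_mul, zero_mul, Finset.sum_ite_eq, Finset.mem_univ, if_true,
    normalPart_graphMap_comp_rho_time hx hhx hne, Fin.sum_univ_succ,
    covariantHessian_graphMap_comp_rho_time hx hh hy,
    covariantHessian_graphMap_height _ hx, Fin.succ_ne_zero, if_false,
    Finset.sum_const, Finset.card_univ, Fintype.card_fin, nsmul_eq_mul]
  push_cast
  field_simp
  ring

theorem one_lt_abs_of_inducedMetric_neg (hx : x 0 ≠ 0) (hh : HasDerivAt h a (rho x))
    {X : Fin n → ℝ}
    (hX : ∑ i, ∑ j, inducedMetric (metric n) (graphMap (h ∘ rho)) x i j * X i * X j < 0) :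
    1 < |a| := by
  rw [← one_lt_sq_iff_one_lt_abs]
  by_contra! hle
  have hnonneg : ∀ i : Fin n, 0 ≤ (if i = 0 then 1 - a ^ 2 else 1) / x 0 ^ 2 := fun i => by
    refine div_nonneg ?_ (sq_nonneg _)
    split_ifs
    exacts [sub_nonneg.2 hle, zero_le_one]
  simp only [inducedMetric_graphMap_comp_rho hx hh, Matrix.diagonal_apply, ite_mul, zero_mul,
    Finset.sum_ite_eq, Finset.mem_univ, if_true, mul_assoc] at hX
  exact hX.not_ge (Finset.sum_nonneg fun i _ => mul_nonneg (hnonneg i) (mul_self_nonneg _))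

theorem slopeField_of_meanCurvatureVector_eq (hx : x 0 ≠ 0)
    (hh : ∀ᶠ s in 𝓝 (rho x), HasDerivAt h (y s) s) (hy : HasDerivAt y y' (rho x))
    (hne : 1 - y (rho x) ^ 2 ≠ 0)
    (hH : meanCurvatureVector (metric n) (graphMap (h ∘ rho)) x =
      normalPart (metric n) (graphMap (h ∘ rho)) x (timeField n)) :
    y' = slopeField (n - 1) (y (rho x)) := by
  have htime := congrFun hH (.inr ())
  rw [meanCurvatureVector_graphMap_comp_rho_time hx hh hy hne,
    normalPart_graphMap_comp_rho_time hx hh.self_of_nhds hne] at htime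
  simp only [timeField, Pi.single_eq_same, ne_eq, reduceCtorEq, not_false_eq_true,
    Pi.single_eq_of_ne, mul_zero, zero_div, add_zero] at htime
  rw [slopeField]
  field_simp at htime
  linear_combination htime

end Geometry

/-! ### Foliations by horospheres -/

section Foliated

variable {n : ℕ} [NeZero n] {Ω : Set (Fin n → ℝ)} {u : (Fin n → ℝ) → ℝ} {I : Set ℝ}

/-- The set `ρ⁻¹(I)` of the half-space model; `rho` is cut down to the half-space because of
its junk values outside. -/
def horoslab (n : ℕ) [NeZero n] (I : Set ℝ) : Set (Fin n → ℝ) :=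
  {x | x ∈ halfSpace n ∧ rho x ∈ I}

/-- The unit speed geodesic `s ↦ (e^{-s}, 0, …, 0)`, which is orthogonal to the horospheres and is
a section of `ρ`. -/
def verticalGeodesic (n : ℕ) [NeZero n] (s : ℝ) : Fin n → ℝ :=
  Pi.single 0 (Real.exp (-s))

theorem verticalGeodesic_mem_halfSpace (s : ℝ) : verticalGeodesic n s ∈ halfSpace n := by
  simp [verticalGeodesic, halfSpace, Real.exp_pos]

theorem rho_verticalGeodesic (s : ℝ) : rho (verticalGeodesic n s) = s := by
  simp [verticalGeodesic, rho]

theorem contDiff_verticalGeodesic {k : WithTop ℕ∞} : ContDiff ℝ k (verticalGeodesic n) :=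
  (ContinuousLinearMap.single ℝ (fun _ : Fin n => ℝ) 0).contDiff.comp (by fun_prop)

theorem verticalGeodesic_rho_zero {x : Fin n → ℝ} (hx : x ∈ halfSpace n) :
    verticalGeodesic n (rho x) 0 = x 0 := by
  simp [verticalGeodesic, rho, Real.exp_log hx]

theorem continuousOn_rho : ContinuousOn (rho (n := n)) (halfSpace n) :=
  ((continuous_apply 0).continuousOn.log fun _ hx => ne_of_gt hx).neg

theorem verticalGeodesic_mem_horoslab_iff {s : ℝ} :
    verticalGeodesic n s ∈ horoslab n I ↔ s ∈ I := by
  simp [horoslab, verticalGeodesic_mem_halfSpace, rho_verticalGeodesic]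

theorem isOpen_of_isOpen_horoslab (h : IsOpen (horoslab n I)) : IsOpen I := by
  convert h.preimage (contDiff_verticalGeodesic (k := 0)).continuous
  ext s
  exact verticalGeodesic_mem_horoslab_iff.symm

theorem isPreconnected_of_isPreconnected_horoslab (h : IsPreconnected (horoslab n I)) :
    IsPreconnected I := by
  convert h.image rho (continuousOn_rho.mono fun x hx => hx.1)
  ext s
  refine ⟨fun hs => ⟨_, verticalGeodesic_mem_horoslab_iff.2 hs, rho_verticalGeodesic s⟩, ?_⟩
  rintro ⟨x, hx, rfl⟩
  exact hx.2

theorem foliatedByHorospheres_iff : FoliatedByHorospheres Ω u ↔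
    ∃ (I : Set ℝ) (h : ℝ → ℝ), Ω = horoslab n I ∧ EqOn u (h ∘ rho) Ω := by
  refine ⟨fun hfol => ?_, ?_⟩
  · have hleaf : ∀ p ∈ Ω, ∀ q, q 0 = p 0 → q ∈ Ω ∧ u q = u p := fun p hp q hqp => by
      obtain ⟨c, -, hpc, hc⟩ := hfol p hp
      exact hc q (hqp.trans hpc)
    have hΩH : Ω ⊆ halfSpace n := fun p hp => by
      obtain ⟨c, hc0, hpc, -⟩ := hfol p hp
      exact hc0.trans_eq hpc.symm
    refine ⟨verticalGeodesic n ⁻¹' Ω, u ∘ verticalGeodesic n, ?_, fun x hx =>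
      (hleaf x hx _ (verticalGeodesic_rho_zero (hΩH hx))).2.symm⟩
    ext x
    exact ⟨fun hx => ⟨hΩH hx, (hleaf x hx _ (verticalGeodesic_rho_zero (hΩH hx))).1⟩,
      fun ⟨hx, hx'⟩ => (hleaf _ hx' x (verticalGeodesic_rho_zero hx).symm).1⟩
  · rintro ⟨I, h, rfl, huh⟩ p ⟨hp, hpI⟩
    refine ⟨p 0, hp, rfl, fun q hq => ?_⟩
    have hqp : rho q = rho p := congrArg (fun r => -Real.log r) hq
    have hqI : q ∈ horoslab n I := ⟨hp.trans_eq (Eq.symm hq), hqp ▸ hpI⟩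
    exact ⟨hqI, by rw [huh hqI, huh ⟨hp, hpI⟩, Function.comp_apply, hqp, Function.comp_apply]⟩

theorem contDiffOn_of_contDiffOn_comp_rho {h : ℝ → ℝ} {k : WithTop ℕ∞}
    (hu : ContDiffOn ℝ k (h ∘ rho) (horoslab n I)) : ContDiffOn ℝ k h I :=
  (hu.comp contDiff_verticalGeodesic.contDiffOn fun _ =>
    verticalGeodesic_mem_horoslab_iff.2).congr fun s _ => by
      simp [rho_verticalGeodesic]

theorem one_lt_abs_deriv_and_hasDerivAt_deriv {h : ℝ → ℝ} (hI : IsOpen I) (hh : ContDiffOn ℝ 2 h I)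
    (htime : IsTimelike (metric n) (horoslab n I) (graphMap (h ∘ rho)))
    (htrans : IsTranslator (metric n) (timeField n) (horoslab n I) (graphMap (h ∘ rho)))
    {s : ℝ} (hs : s ∈ I) :
    1 < |deriv h s| ∧ HasDerivAt (deriv h) (slopeField (n - 1) (deriv h s)) s := by
  have hh' : ContDiffOn ℝ 1 (deriv h) I := hh.deriv_of_isOpen hI (by norm_num)
  have hderiv : ∀ r ∈ I, HasDerivAt h (deriv h r) r := fun r hr =>
    ((hh.differentiableOn two_ne_zero).differentiableAt (hI.mem_nhds hr)).hasDerivAt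
  have hderiv' : HasDerivAt (deriv h) (deriv (deriv h) s) s :=
    ((hh'.differentiableOn one_ne_zero).differentiableAt (hI.mem_nhds hs)).hasDerivAt
  obtain ⟨x, hx, rfl⟩ : ∃ x ∈ horoslab n I, rho x = s :=
    ⟨_, verticalGeodesic_mem_horoslab_iff.2 hs, rho_verticalGeodesic s⟩
  have hx0 : x 0 ≠ 0 := ne_of_gt hx.1
  obtain ⟨-, X, hX⟩ := htime x hx
  have habs := one_lt_abs_of_inducedMetric_neg hx0 (hderiv _ hs) hX
  have hne : 1 - deriv h (rho x) ^ 2 ≠ 0 :=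
    (sub_neg.2 (one_lt_sq_iff_one_lt_abs _ |>.2 habs)).ne
  refine ⟨habs, hderiv'.congr_deriv ?_⟩
  exact slopeField_of_meanCurvatureVector_eq hx0 (eventually_of_mem (hI.mem_nhds hs) hderiv)
    hderiv' hne (htrans x hx).2

theorem FoliatedByHorospheres.exists_isPrimitiveOfInverse {G : ℝ → ℝ} {c : ℝ}
    (hfol : FoliatedByHorospheres Ω u) (hG : IsTimeMap (n - 1) c G) (hn : 2 ≤ n)
    (hΩo : IsOpen Ω) (hΩc : IsPreconnected Ω) (hu : ContDiffOn ℝ 2 u Ω)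
    (htime : IsTimelike (metric n) Ω (graphMap u))
    (htrans : IsTranslator (metric n) (timeField n) Ω (graphMap u)) :
    ∃ (I : Set ℝ) (f : ℝ → ℝ) (s₀ : ℝ),
      IsOpen I ∧ I.OrdConnected ∧ I ⊆ Iio (s₀ + c) ∧ Ω = horoslab n I ∧ EqOn u (f ∘ rho) Ω ∧
      (IsPrimitiveOfInverse G (Iio (-1)) c s₀ f ∨ IsPrimitiveOfInverse G (Ioi 1) c s₀ f) := by
  obtain ⟨I, h, rfl, huh⟩ := foliatedByHorospheres_iff.1 hfol
  have hgraph : EqOn (graphMap u) (graphMap (h ∘ rho)) (horoslab n I) := fun x hx => by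
    simp only [graphMap, huh hx]
  have hI := isOpen_of_isOpen_horoslab hΩo
  have hIc := isPreconnected_of_isPreconnected_horoslab hΩc
  have hh : ContDiffOn ℝ 2 h I :=
    contDiffOn_of_contDiffOn_comp_rho (hu.congr fun x hx => (huh hx).symm)
  have hode : ∀ s ∈ I, 1 < |deriv h s| ∧
      HasDerivAt (deriv h) (slopeField (n - 1) (deriv h s)) s := fun s hs =>
    one_lt_abs_deriv_and_hasDerivAt_deriv hI hh (htime.congr hΩo hgraph)
      (htrans.congr hΩo hgraph) hs
  have hm : (1 : ℝ) ≤ n - 1 := by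
    rw [le_sub_iff_add_le, one_add_one_eq_two]
    exact_mod_cast hn
  obtain ⟨f, s₀, hIs, hhf, hf⟩ := hG.exists_isPrimitiveOfInverse_eqOn hm hI hIc
    (fun s hs => ((hh.differentiableOn two_ne_zero).differentiableAt (hI.mem_nhds hs)).hasDerivAt)
    (fun s hs => (hode s hs).2) fun s hs => (hode s hs).1
  exact ⟨I, f, s₀, hI, hIc.ordConnected, hIs, rfl, fun x hx => (huh hx).trans (hhf hx.2), hf⟩

end Foliated

end HESU

end

theorem theorem3p2 (n : ℕ) [NeZero n] (hn : 2 ≤ n)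
    (Ω : Set (Fin n → ℝ)) (hΩH : Ω ⊆ HESU.halfSpace n) (hΩo : IsOpen Ω) (hΩc : IsConnected Ω)
    (u : (Fin n → ℝ) → ℝ) (hu : ContDiffOn ℝ 2 u Ω)
    (htime : HESU.IsTimelike (HESU.metric n) Ω (HESU.graphMap u))
    (htrans : HESU.IsTranslator (HESU.metric n) (HESU.timeField n) Ω (HESU.graphMap u)) :
    HESU.FoliatedByHorospheres Ω u ↔
      ∃ (I : Set ℝ) (f : ℝ → ℝ) (s₀ c : ℝ),
        IsOpen I ∧ I.OrdConnected ∧ I ⊆ Set.Iio (s₀ + c) ∧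
        Ω = {x | x ∈ HESU.halfSpace n ∧ HESU.rho x ∈ I} ∧
        (∀ x ∈ Ω, u x = f (HESU.rho x)) ∧
        ((n = 2 ∧ c = 0 ∧
            (HESU.IsPrimitiveOfInverse HESU.P (Set.Iio (-1)) c s₀ f ∨
              HESU.IsPrimitiveOfInverse HESU.P (Set.Ioi 1) c s₀ f)) ∨
          (2 < n ∧ c = ((n : ℝ) - 1) / (2 * n - (n : ℝ) ^ 2) * Real.log ((n : ℝ) - 1) ∧
            (HESU.IsPrimitiveOfInverse (HESU.Q ((n : ℝ) - 1)) (Set.Iio (-1)) c s₀ f ∨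
              HESU.IsPrimitiveOfInverse (HESU.Q ((n : ℝ) - 1)) (Set.Ioi 1) c s₀ f))) := by
  refine ⟨fun hfol => ?_, fun ⟨I, f, _, _, _, _, _, hΩ, huf, _⟩ =>
    HESU.foliatedByHorospheres_iff.2 ⟨I, f, hΩ, huf⟩⟩
  rcases hn.eq_or_lt with rfl | hn2
  · have hG : HESU.IsTimeMap (((2 : ℕ) : ℝ) - 1) 0 HESU.P := by
      convert HESU.isTimeMap_P using 1
      norm_num
    obtain ⟨I, f, s₀, hI, hIc, hIs, hΩ, huf, hf⟩ :=
      hfol.exists_isPrimitiveOfInverse hG hn hΩo hΩc.isPreconnected hu htime htrans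
    exact ⟨I, f, s₀, 0, hI, hIc, hIs, hΩ, huf, .inl ⟨rfl, rfl, hf⟩⟩
  · have hm : (1 : ℝ) < n - 1 := by
      rw [lt_sub_iff_add_lt, one_add_one_eq_two]
      exact_mod_cast hn2
    obtain ⟨I, f, s₀, hI, hIc, hIs, hΩ, huf, hf⟩ := hfol.exists_isPrimitiveOfInverse
      (HESU.isTimeMap_Q hm) hn hΩo hΩc.isPreconnected hu htime htrans
    refine ⟨I, f, s₀, _, hI, hIc, hIs, hΩ, huf, .inr ⟨hn2, ?_, hf⟩⟩
    rw [show (2 * n - n ^ 2 : ℝ) = 1 - (n - 1) ^ 2 by ring]
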